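/- Let $f:(0,\infty)\to(0,\infty)$ be three times differentiable with $f'(x)>0$ for all $x>0$, and suppose that, as $x\to\infty$, $$\text{(i) } f(x)\to\infty,\qquad \text{(ii) } \frac{f'(x)}{f(x)}\to 0,\qquad \text{(iii) } \frac{f''(x)/f'(x)}{f'(x)/f(x)}=O(1),\qquad \text{(iv) } \frac{f'''(x)\,f(x)^2}{f'(x)^3}=O(1).$$ Put $a_j=1/f(j)$ and $A_N=\sum_{j=1}^N a_j$. For each integer $N\ge 1$ let coupons of the types $1,\dots,N$ be sampled independently with replacement, each sampled coupon being of type $j$ with probability $p_j=a_j/A_N$ ($1\le j\le N$). Fix an integer $m\ge 1$ and let $T_m(N)$ be the least number of trials after which every one of the $N$ types has been obtained at least $m$ times. Set $$\rho(N)=\ln\frac{f(N)}{f'(N)},\qquad b_N=A_N f(N)\,\big[\rho(N)+(m-2)\ln\rho(N)\big],\qquad k_N=A_N f(N)$$ (here $\ln\rho(N)$ is defined for all sufficiently large $N$). Then $y\mapsto\exp\!\big(-e^{-y}/(m-1)!\big)$ is the distribution function of a probability law on $\mathbb R$, and $(T_m(N)-b_N)/k_N$ converges in distribution to this law; that is,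 for every $y\in\mathbb{R}$, $$P\left\{\frac{T_m(N)-b_N}{k_N}\le y\right\}\longrightarrow \exp\left(-\frac{e^{-y}}{(m-1)!}\right),\qquad N\to\infty.$$ -/

import Mathlib

open MeasureTheory ProbabilityTheory Filter Topology Asymptotics

open scoped ENNReal

noncomputable section

namespace CouponCollector

/-- The class of growth functions: `f` is positive with positive derivative and three times
differentiable on `(0, ∞)`, and satisfies the four growth conditions as `x → ∞`. -/
structure GrowthConditions (f : ℝ → ℝ) : Prop where
  pos : ∀ x, 0 < x → 0 < f x
  deriv_pos : ∀ x, 0 < x → 0 < deriv f x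
  diff_one : ∀ x, 0 < x → DifferentiableAt ℝ f x
  diff_two : ∀ x, 0 < x → DifferentiableAt ℝ (deriv f) x
  diff_three : ∀ x, 0 < x → DifferentiableAt ℝ (deriv (deriv f)) x
  tendsto_atTop : Tendsto f atTop atTop
  log_deriv : Tendsto (fun x => deriv f x / f x) atTop (𝓝 0)
  second_order : (fun x => (deriv (deriv f) x / deriv f x) / (deriv f x / f x))
    =O[atTop] (fun _ => (1 : ℝ))
  third_order : (fun x => deriv (deriv (deriv f)) x * f x ^ 2 / deriv f x ^ 3)
    =O[atTop] (fun _ => (1 : ℝ))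

/-- The weight `a_j = 1 / f(j)`. -/
def weight (f : ℝ → ℝ) (j : ℕ) : ℝ := 1 / f j

/-- `A_N = a_1 + ⋯ + a_N`. -/
def weightSum (f : ℝ → ℝ) (N : ℕ) : ℝ := ∑ j ∈ Finset.Icc 1 N, weight f j

/-- The coupon probability `p_j = a_j / A_N`, for `1 ≤ j ≤ N`. -/
def couponProb (f : ℝ → ℝ) (N j : ℕ) : ℝ := weight f j / weightSum f N

/-- The types `X 0, X 1, X 2, …` recorded in successive trials are independent, each with values
`1, …, N` taken with probabilities `p 1, …, p N` (which are meant to sum to one). -/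
structure IsSampling {Ω : Type*} [MeasurableSpace Ω] (P : Measure Ω) (N : ℕ) (p : ℕ → ℝ)
    (X : ℕ → Ω → ℕ) : Prop where
  measurable : ∀ i, Measurable (X i)
  indep : iIndepFun X P
  law : ∀ i, ∀ j ∈ Finset.Icc 1 N, P {ω | X i ω = j} = ENNReal.ofReal (p j)

/-- The number of coupons of type `j` among the first `n` trials. -/
def count {Ω : Type*} (X : ℕ → Ω → ℕ) (j n : ℕ) (ω : Ω) : ℕ :=
  ((Finset.range n).filter (fun i => X i ω = j)).card

/-- `T_m(N)`: the least number `n` of trials after which each of the types `1, …, N` has been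
obtained at least `m` times (`⊤` if this never happens). -/
def collectionTime {Ω : Type*} (X : ℕ → Ω → ℕ) (m N : ℕ) (ω : Ω) : ℕ∞ :=
  sInf {t : ℕ∞ | ∃ n : ℕ, t = n ∧ ∀ j ∈ Finset.Icc 1 N, m ≤ count X j n ω}

/-- `ρ(N) = ln (f(N) / f'(N))`. -/
def rho (f : ℝ → ℝ) (N : ℕ) : ℝ := Real.log (f N / deriv f N)

/-- `b_N = A_N f(N) [ρ(N) + (m - 2) ln ρ(N)]`. -/
def centering (f : ℝ → ℝ) (m N : ℕ) : ℝ :=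
  weightSum f N * f N * (rho f N + ((m : ℝ) - 2) * Real.log (rho f N))

/-- `k_N = A_N f(N)`. -/
def scaling (f : ℝ → ℝ) (N : ℕ) : ℝ := weightSum f N * f N

/-- The limiting distribution function `y ↦ exp (-e^{-y} / (m - 1)!)`, for `m ≥ 1`. -/
def limitCDF (m : ℕ) (y : ℝ) : ℝ := Real.exp (-(Real.exp (-y) / ((m - 1).factorial : ℝ)))

/-- The normalized collection time `(T_m(N) - b_N) / k_N`, as an extended real number. -/
def normalizedTime {Ω : Type*} (f : ℝ → ℝ) (X : ℕ → Ω → ℕ) (m N : ℕ) (ω : Ω) : EReal :=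
  (((collectionTime X m N ω : ℝ≥0∞) : EReal) - (centering f m N : EReal)) /
    (scaling f N : EReal)

end CouponCollector

end

/-!
Let `g = f / f'`, so that `ρ(N) = log g(N)`, and put `s = ρ(N) + (m - 2) ln ρ(N) + y`
(`normTime`). Then `b_N + k_N y = k_N s`, and in a Poisson stream of mean length `k_N s` the number
of coupons of type `j` has mean `p_j k_N s = s f(N) / f(j)`.

*Poissonization.* The probability that `n` draws meet a demand vector `c` satisfies a recursion
obtained by conditioning on the last draw, which lowers one coordinate of `c`. The truncated
exponential series `z ↦ exp z - ∑ k < c, z ^ k / k!` are differentiated by lowering `c`, so the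
Taylor coefficients at `0` of their product over the types satisfy the same recursion. Hence the
exponential generating function of these probabilities is this product (`hasSum_poissonization`,
`hasSum_collection`): for a Poisson number of draws the types are independent. Since the
probabilities increase with `n`, Chebyshev's inequality for the Poisson law brings the result back
to a fixed number of draws at the price of a small shift of `y` (`le_poisson_average_add`,
`poisson_average_sub_le`); the error is at most of the order of `ρ(N) / N`, and `ρ(N) = O(log N)`.

*The Poissonized limit.* The probability that all types have been drawn `m` times is
`∏ (1 - x_j)`, where `x_j` is the probability that a Poisson variable with mean `s f(N) / f(j)` is
less than `m`. The `x_j` are uniformly small, so the limit is `exp (-lim ∑ x_j)`. Each sum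
`∑ exp (-λ_j) λ_j ^ k` with `λ_j = s f(N) / f(j)` is asymptotic to `g(N) s ^ (k - 1) exp (-s)`
(`tendsto_sum_poissonTerm`): as `g'` is bounded, `g` varies at most like a power of `f`
(`quot_compare`), and this gives functions with explicit antiderivatives just above and just below
the summand. For `k = m - 1` the value tends to `exp (-y)`, for smaller `k` to `0`
(`tendsto_mass`).
-/

open MeasureTheory ProbabilityTheory Filter Topology Asymptotics

open scoped ENNReal

namespace CouponCollector

/-! ### The generating function of the Poissonized problem -/

/-- The exponential series with its terms of degree `< c` removed; `exp (-t) * expTail c t` is the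
probability that a Poisson variable with mean `t` is at least `c`. -/
noncomputable def expTail (c : ℕ) (z : ℂ) : ℂ :=
  Complex.exp z - ∑ k ∈ Finset.range c, z ^ k / (k.factorial : ℂ)

lemma expTail_zero_right (c : ℕ) : expTail c 0 = if c = 0 then 1 else 0 := by
  cases c with
  | zero => simp [expTail]
  | succ c => simp [expTail, Finset.sum_range_succ', zero_pow]

lemma hasDerivAt_expTail (c : ℕ) (z : ℂ) : HasDerivAt (expTail c) (expTail (c - 1) z) z := by
  cases c with
  | zero =>
    have h : expTail 0 = Complex.exp := by ext z; simp [expTail]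
    simpa [h] using Complex.hasDerivAt_exp z
  | succ c =>
    have h : HasDerivAt (fun z : ℂ => ∑ k ∈ Finset.range (c + 1), z ^ k / (k.factorial : ℂ))
        (∑ k ∈ Finset.range (c + 1), (k : ℂ) * z ^ (k - 1) / (k.factorial : ℂ)) z :=
      HasDerivAt.fun_sum fun k _ => (hasDerivAt_pow k z).div_const _
    have h2 := (Complex.hasDerivAt_exp z).sub h
    convert! h2 using 1
    rw [expTail, Finset.sum_range_succ']
    simp only [Nat.add_sub_cancel, Nat.cast_zero, zero_mul, zero_div, add_zero]
    congr 1
    refine Finset.sum_congr rfl fun k _ => ?_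
    have : ((k.factorial : ℕ) : ℂ) ≠ 0 := by exact_mod_cast k.factorial_ne_zero
    have h3 : ((k : ℂ) + 1) ≠ 0 := by exact_mod_cast k.succ_ne_zero
    rw [Nat.factorial_succ]
    push_cast
    field_simp

/-- The product over `j ∈ s` of the truncated exponential series in `p j * z`. It is the
exponential generating function of the probabilities that each type `j ∈ s` has been drawn at
least `c j` times. -/
noncomputable def tailProd (s : Finset ℕ) (p : ℕ → ℝ) (c : ℕ → ℕ) (z : ℂ) : ℂ :=
  ∏ j ∈ s, expTail (c j) (p j * z)

lemma hasDerivAt_tailProd (s : Finset ℕ) (p : ℕ → ℝ) (c : ℕ → ℕ) (z : ℂ) :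
    HasDerivAt (tailProd s p c)
      (∑ i ∈ s, (p i : ℂ) * tailProd s p (Function.update c i (c i - 1)) z) z := by
  have h : ∀ i ∈ s, HasDerivAt (fun z : ℂ => expTail (c i) (p i * z))
      (expTail (c i - 1) (p i * z) * p i) z := fun i _ => by
    have h1 : HasDerivAt (fun z : ℂ => (p i : ℂ) * z) (p i) z := by
      simpa using (hasDerivAt_id z).const_mul (p i : ℂ)
    exact (hasDerivAt_expTail (c i) (p i * z)).comp z h1
  have h2 := HasDerivAt.fun_finsetProd h
  convert! h2 using 1
  refine Finset.sum_congr rfl fun i hi => ?_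
  rw [tailProd, ← Finset.mul_prod_erase s _ hi, smul_eq_mul]
  have : ∏ x ∈ s.erase i, expTail (Function.update c i (c i - 1) x) (p x * z)
      = ∏ x ∈ s.erase i, expTail (c x) (p x * z) :=
    Finset.prod_congr rfl fun x hx => by
      rw [Function.update_of_ne (Finset.ne_of_mem_erase hx)]
  rw [this, Function.update_self]
  ring

lemma differentiable_tailProd (s : Finset ℕ) (p : ℕ → ℝ) (c : ℕ → ℕ) :
    Differentiable ℂ (tailProd s p c) :=
  fun z => (hasDerivAt_tailProd s p c z).differentiableAt

lemma contDiff_tailProd (s : Finset ℕ) (p : ℕ → ℝ) (c : ℕ → ℕ) {n : WithTop ℕ∞} :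
    ContDiff ℂ n (tailProd s p c) :=
  (differentiable_tailProd s p c).contDiff

/-- The hypotheses on `u` are those met by the probability that `n` independent draws contain at
least `c j` coupons of each type `j ∈ s`. The subtraction `c i - 1` is truncated, in agreement with
a demand of zero staying zero. -/
lemma iteratedDeriv_tailProd_zero (s : Finset ℕ) (p : ℕ → ℝ) (u : (ℕ → ℕ) → ℕ → ℝ)
    (h0 : ∀ c, u c 0 = if ∀ j ∈ s, c j = 0 then 1 else 0)
    (hs : ∀ c n, u c (n + 1) = ∑ i ∈ s, p i * u (Function.update c i (c i - 1)) n)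
    (n : ℕ) (c : ℕ → ℕ) : iteratedDeriv n (tailProd s p c) 0 = u c n := by
  induction n generalizing c with
  | zero =>
    rw [iteratedDeriv_zero, h0, tailProd]
    simp only [mul_zero, expTail_zero_right]
    rw [Finset.prod_ite_zero]
    split_ifs <;> simp
  | succ n ih =>
    have hd : deriv (tailProd s p c) =
        fun z => ∑ i ∈ s, (p i : ℂ) * tailProd s p (Function.update c i (c i - 1)) z :=
      funext fun z => (hasDerivAt_tailProd s p c z).deriv
    rw [iteratedDeriv_succ', hd, iteratedDeriv_fun_sum, hs]
    · push_cast
      refine Finset.sum_congr rfl fun i _ => ?_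
      rw [iteratedDeriv_const_mul_field, ih]
    · exact fun i _ => (contDiff_const.mul (contDiff_tailProd _ _ _)).contDiffAt

/-- Poissonization: a solution of the recursion obtained by conditioning on one draw has an
exponential generating function that factors over the types. -/
lemma hasSum_poissonization (s : Finset ℕ) (p : ℕ → ℝ) (u : (ℕ → ℕ) → ℕ → ℝ)
    (h0 : ∀ c, u c 0 = if ∀ j ∈ s, c j = 0 then 1 else 0)
    (hs : ∀ c n, u c (n + 1) = ∑ i ∈ s, p i * u (Function.update c i (c i - 1)) n)
    (c : ℕ → ℕ) (t : ℝ) :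
    HasSum (fun n : ℕ => t ^ n / (n.factorial : ℝ) * u c n)
      (∏ j ∈ s, (Real.exp (p j * t) -
        ∑ k ∈ Finset.range (c j), (p j * t) ^ k / (k.factorial : ℝ))) := by
  have h := Complex.hasSum_taylorSeries_of_entire (differentiable_tailProd s p c) 0 (t : ℂ)
  rw [← Complex.hasSum_ofReal]
  convert! h using 1
  · ext n
    rw [iteratedDeriv_tailProd_zero s p u h0 hs]
    push_cast
    simp only [sub_zero, smul_eq_mul]
    ring
  · simp [tailProd, expTail]

/-! ### Counts under independent sampling -/

section Sampling

variable {Ω : Type*} {N : ℕ} {X : ℕ → Ω → ℕ}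

lemma count_succ (X : ℕ → Ω → ℕ) (j n : ℕ) (ω : Ω) :
    count X j (n + 1) ω = count X j n ω + if X n ω = j then 1 else 0 := by
  unfold count
  rw [Finset.range_add_one, Finset.filter_insert]
  split_ifs with h
  · rw [Finset.card_insert_of_notMem (by simp)]
  · simp

lemma count_mono (X : ℕ → Ω → ℕ) (j : ℕ) (ω : Ω) : Monotone fun n => count X j n ω :=
  monotone_nat_of_le_succ fun n => by rw [count_succ]; exact Nat.le_add_right _ _

/-- The event that each type `j` in `1, …, N` has been drawn at least `c j` times in `n` trials. -/
def allCounts (X : ℕ → Ω → ℕ) (N : ℕ) (c : ℕ → ℕ) (n : ℕ) : Set Ω :=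
  {ω | ∀ j ∈ Finset.Icc 1 N, c j ≤ count X j n ω}

lemma allCounts_mono (X : ℕ → Ω → ℕ) (N : ℕ) (c : ℕ → ℕ) : Monotone (allCounts X N c) :=
  fun _ _ hab ω h j hj => (h j hj).trans (count_mono X j ω hab)

/-- After a draw of type `i`, the demand `c` is met exactly if the earlier draws meet the demand
lowered by one at `i`. -/
lemma mem_allCounts_succ {i n : ℕ} {c : ℕ → ℕ} {ω : Ω} (h : X n ω = i) :
    ω ∈ allCounts X N c (n + 1) ↔
      ω ∈ allCounts X N (Function.update c i (c i - 1)) n := by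
  refine forall₂_congr fun j _ => ?_
  rw [count_succ, h]
  rcases eq_or_ne j i with rfl | hji
  · simp
  · rw [Function.update_of_ne hji, if_neg hji.symm, add_zero]

/-- The event `allCounts` depends only on the first `n` trials. -/
lemma allCounts_eq_preimage (X : ℕ → Ω → ℕ) (N : ℕ) (c : ℕ → ℕ) (n : ℕ) :
    ∃ S : Set (Finset.range n → ℕ),
      allCounts X N c n = (fun ω (i : Finset.range n) => X i ω) ⁻¹' S := by
  refine ⟨{x | ∀ j ∈ Finset.Icc 1 N,
    c j ≤ (Finset.univ.filter fun i : Finset.range n => x i = j).card}, ?_⟩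
  ext ω
  refine forall₂_congr fun j _ => ?_
  have : (Finset.univ.filter fun i : Finset.range n => X i ω = j).card = count X j n ω := by
    unfold count
    rw [← Finset.card_map (Function.Embedding.subtype _)]
    congr 1
    ext a
    simp [and_comm]
  rw [this]

variable [MeasurableSpace Ω] {P : Measure Ω} {p : ℕ → ℝ}

lemma IsSampling.measurableSet_allCounts (hX : IsSampling P N p X) (c : ℕ → ℕ) (n : ℕ) :
    MeasurableSet (allCounts X N c n) := by
  obtain ⟨S, hS⟩ := allCounts_eq_preimage X N c n
  rw [hS]
  exact measurable_pi_lambda (fun ω (i : Finset.range n) => X i ω) (fun i => hX.measurable i)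
    MeasurableSet.of_discrete

lemma IsSampling.real_inter (hX : IsSampling P N p X) (hp : ∀ j ∈ Finset.Icc 1 N, 0 ≤ p j)
    (c : ℕ → ℕ) (n i : ℕ) (hi : i ∈ Finset.Icc 1 N) :
    P.real (allCounts X N c n ∩ {ω | X n ω = i}) = p i * P.real (allCounts X N c n) := by
  obtain ⟨S, hS⟩ := allCounts_eq_preimage X N c n
  have hind := hX.indep.indepFun_finset (Finset.range n) {n} (by simp) hX.measurable
  have h := hind.measure_inter_preimage_eq_mul S {x | x ⟨n, by simp⟩ = i}
    .of_discrete .of_discrete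
  rw [← hS] at h
  have h2 := hX.law n i hi
  rw [Measure.real, Measure.real]
  change P (allCounts X N c n ∩ {ω | X n ω = i}) = P _ * P {ω | X n ω = i} at h
  rw [h, h2, ENNReal.toReal_mul, ENNReal.toReal_ofReal (hp i hi), mul_comm]

lemma IsSampling.ae_mem [IsProbabilityMeasure P] (hX : IsSampling P N p X)
    (hp : ∀ j ∈ Finset.Icc 1 N, 0 ≤ p j) (hsum : ∑ j ∈ Finset.Icc 1 N, p j = 1) (n : ℕ) :
    ∀ᵐ ω ∂P, X n ω ∈ Finset.Icc 1 N := by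
  have hm : ∀ i, MeasurableSet {ω | X n ω = i} := fun i =>
    hX.measurable n (measurableSet_singleton i)
  have hU : {ω | X n ω ∈ Finset.Icc 1 N} = ⋃ i ∈ Finset.Icc 1 N, {ω | X n ω = i} := by
    ext ω; simp
  change {ω | X n ω ∈ Finset.Icc 1 N} ∈ ae P
  have hmU : MeasurableSet {ω | X n ω ∈ Finset.Icc 1 N} :=
    hX.measurable n (MeasurableSet.of_discrete (s := {i | i ∈ Finset.Icc 1 N}))
  rw [mem_ae_iff_prob_eq_one hmU, hU,
    measure_biUnion_finset _ fun i _ => hm i]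
  · rw [Finset.sum_congr rfl fun i hi => hX.law n i hi, ← ENNReal.ofReal_sum_of_nonneg hp, hsum,
      ENNReal.ofReal_one]
  · intro i _ j _ hij
    exact Set.disjoint_left.2 fun ω (h1 : X n ω = i) (h2 : X n ω = j) => hij (h1 ▸ h2)

lemma IsSampling.real_allCounts_succ [IsProbabilityMeasure P] (hX : IsSampling P N p X)
    (hp : ∀ j ∈ Finset.Icc 1 N, 0 ≤ p j) (hsum : ∑ j ∈ Finset.Icc 1 N, p j = 1)
    (c : ℕ → ℕ) (n : ℕ) :
    P.real (allCounts X N c (n + 1)) = ∑ i ∈ Finset.Icc 1 N,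
      p i * P.real (allCounts X N (Function.update c i (c i - 1)) n) := by
  have hm : ∀ i, MeasurableSet {ω | X n ω = i} := fun i =>
    hX.measurable n (measurableSet_singleton i)
  have h1 : P.real (allCounts X N c (n + 1)) = P.real (⋃ i ∈ Finset.Icc 1 N,
      (allCounts X N (Function.update c i (c i - 1)) n ∩ {ω | X n ω = i})) := by
    refine measureReal_congr ?_
    filter_upwards [hX.ae_mem hp hsum n] with ω hω
    refine propext ?_
    change ω ∈ allCounts X N c (n + 1) ↔ ω ∈ ⋃ i ∈ Finset.Icc 1 N,
      (allCounts X N (Function.update c i (c i - 1)) n ∩ {ω | X n ω = i})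
    rw [mem_allCounts_succ rfl]
    simp only [Set.mem_iUnion]
    constructor
    · exact fun h => ⟨X n ω, hω, h, rfl⟩
    · rintro ⟨i, _, h, rfl⟩
      exact h
  rw [h1, measureReal_biUnion_finset]
  · exact Finset.sum_congr rfl fun i hi => hX.real_inter hp _ n i hi
  · intro i _ j _ hij
    exact Set.disjoint_left.2 fun ω h1 h2 => hij (h1.2 ▸ h2.2)
  · exact fun i _ => (hX.measurableSet_allCounts _ n).inter (hm i)

/-- The exponential generating function of the probabilities that `n` trials suffice. -/
lemma IsSampling.hasSum_real_allCounts [IsProbabilityMeasure P] (hX : IsSampling P N p X)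
    (hp : ∀ j ∈ Finset.Icc 1 N, 0 ≤ p j) (hsum : ∑ j ∈ Finset.Icc 1 N, p j = 1)
    (m : ℕ) (t : ℝ) :
    HasSum (fun n : ℕ => t ^ n / (n.factorial : ℝ) * P.real (allCounts X N (fun _ => m) n))
      (∏ j ∈ Finset.Icc 1 N, (Real.exp (p j * t) -
        ∑ k ∈ Finset.range m, (p j * t) ^ k / (k.factorial : ℝ))) := by
  refine hasSum_poissonization (Finset.Icc 1 N) p (fun c n => P.real (allCounts X N c n))
    (fun c => ?_) (fun c n => hX.real_allCounts_succ hp hsum c n) (fun _ => m) t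
  split_ifs with h
  · have : allCounts X N c 0 = Set.univ :=
      Set.eq_univ_of_forall fun ω j hj => by simp [h j hj]
    rw [this, probReal_univ]
  · have : allCounts X N c 0 = ∅ :=
      Set.eq_empty_of_forall_notMem fun ω hω => h fun j hj => by
        simpa [count] using hω j hj
    rw [this, measureReal_empty]

end Sampling

/-! ### Poisson weights -/

lemma hasSum_poisson_weights (t : ℝ) :
    HasSum (fun n : ℕ => t ^ n / (n.factorial : ℝ)) (Real.exp t) := by
  rw [Real.exp_eq_exp_ℝ]
  exact NormedSpace.expSeries_div_hasSum_exp t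

/-- The variance of a Poisson variable with mean `t` is `t`, for unnormalized weights. -/
lemma hasSum_poisson_weights_variance (t : ℝ) :
    HasSum (fun n : ℕ => t ^ n / (n.factorial : ℝ) * ((n : ℝ) - t) ^ 2) (t * Real.exp t) := by
  have h0 := hasSum_poisson_weights t
  have hshift : ∀ (g : ℕ → ℝ) (a : ℝ),
      HasSum (fun n : ℕ => t ^ n / (n.factorial : ℝ) * g n) a →
      HasSum (fun n : ℕ => t ^ n / (n.factorial : ℝ) * (n * g (n - 1))) (t * a) := by
    intro g a h
    rw [← hasSum_nat_add_iff' 1]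
    convert! h.mul_left t using 1
    · ext n
      have : ((n.factorial : ℕ) : ℝ) ≠ 0 := by exact_mod_cast n.factorial_ne_zero
      have h3 : ((n : ℝ) + 1) ≠ 0 := by exact_mod_cast n.succ_ne_zero
      rw [Nat.factorial_succ, Nat.add_sub_cancel]
      push_cast
      field_simp
      ring
    · simp
  have h1 := hshift (fun _ => 1) (Real.exp t) (by simpa using h0)
  have h2 := hshift (fun n => (n : ℝ)) _ (by simpa using h1)
  have h3 := (h2.add (h1.mul_left (1 - 2 * t))).add (h0.mul_left (t ^ 2))
  convert! h3 using 1
  · ext n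
    rcases n with _ | n
    · simp
    · push_cast
      ring
  · ring

/-- Depoissonization, upper bound: a monotone sequence bounded by `1` does not exceed its Poisson
average at `t > n` by more than the Chebyshev bound for the lower Poisson tail. -/
lemma le_poisson_average_add {q : ℕ → ℝ} (hmono : Monotone q) (h0 : ∀ n, 0 ≤ q n)
    (h1 : ∀ n, q n ≤ 1) {t R : ℝ} (ht : 0 < t)
    (hR : HasSum (fun n : ℕ => t ^ n / (n.factorial : ℝ) * q n) (Real.exp t * R))
    {n : ℕ} {d : ℝ} (hd : 0 < d) (hn : n + d ≤ t) : q n ≤ R + t / d ^ 2 := by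
  have h := hR.add ((hasSum_poisson_weights_variance t).mul_right (1 / d ^ 2))
  have h2 := (hasSum_poisson_weights t).mul_right (q n)
  have h3 := hasSum_le (fun i => ?_) h2 h
  · have h4 : Real.exp t * q n ≤ Real.exp t * (R + t / d ^ 2) := by
      refine h3.trans (le_of_eq ?_)
      ring
    exact le_of_mul_le_mul_left h4 (Real.exp_pos t)
  · have hw : 0 ≤ t ^ i / (i.factorial : ℝ) := by positivity
    rw [mul_assoc, ← mul_add]
    refine mul_le_mul_of_nonneg_left ?_ hw
    rcases le_or_gt n i with hi | hi
    · have := hmono hi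
      have : 0 ≤ ((i : ℝ) - t) ^ 2 * (1 / d ^ 2) := by positivity
      linarith
    · have hi' : (i : ℝ) ≤ n := by exact_mod_cast hi.le
      have : 1 ≤ ((i : ℝ) - t) ^ 2 * (1 / d ^ 2) := by
        rw [mul_one_div, one_le_div (by positivity)]
        nlinarith
      linarith [h0 i, h1 n]

/-- Depoissonization, lower bound, by the Chebyshev bound for the upper Poisson tail. -/
lemma poisson_average_sub_le {q : ℕ → ℝ} (hmono : Monotone q) (h0 : ∀ n, 0 ≤ q n)
    (h1 : ∀ n, q n ≤ 1) {t R : ℝ} (ht : 0 < t)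
    (hR : HasSum (fun n : ℕ => t ^ n / (n.factorial : ℝ) * q n) (Real.exp t * R))
    {n : ℕ} {d : ℝ} (hd : 0 < d) (hn : t + d ≤ n + 1) : R - t / d ^ 2 ≤ q n := by
  have h := ((hasSum_poisson_weights t).mul_right (q n)).add
    ((hasSum_poisson_weights_variance t).mul_right (1 / d ^ 2))
  have h3 := hasSum_le (fun i => ?_) hR h
  · have h4 : Real.exp t * R ≤ Real.exp t * (q n + t / d ^ 2) := by
      refine h3.trans (le_of_eq ?_)
      ring
    linarith [le_of_mul_le_mul_left h4 (Real.exp_pos t)]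
  · have hw : 0 ≤ t ^ i / (i.factorial : ℝ) := by positivity
    rw [mul_assoc, ← mul_add]
    refine mul_le_mul_of_nonneg_left ?_ hw
    rcases le_or_gt i n with hi | hi
    · have := hmono hi
      have : 0 ≤ ((i : ℝ) - t) ^ 2 * (1 / d ^ 2) := by positivity
      linarith
    · have hi' : (n : ℝ) + 1 ≤ i := by exact_mod_cast hi
      have : 1 ≤ ((i : ℝ) - t) ^ 2 * (1 / d ^ 2) := by
        rw [mul_one_div, one_le_div (by positivity)]
        nlinarith
      linarith [h0 n, h1 i]

/-! ### Products close to one and the Poisson terms -/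

lemma prod_one_sub_le_exp {ι : Type*} (s : Finset ι) (x : ι → ℝ) (h1 : ∀ i ∈ s, x i ≤ 1) :
    ∏ i ∈ s, (1 - x i) ≤ Real.exp (-∑ i ∈ s, x i) := by
  rw [← Finset.sum_neg_distrib, Real.exp_sum]
  exact Finset.prod_le_prod (fun i hi => sub_nonneg.2 (h1 i hi))
    fun i _ => Real.one_sub_le_exp_neg (x i)

lemma exp_le_prod_one_sub {ι : Type*} (s : Finset ι) (x : ι → ℝ) {M : ℝ} (hM : M < 1)
    (h0 : ∀ i ∈ s, 0 ≤ x i) (h1 : ∀ i ∈ s, x i ≤ M) :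
    Real.exp (-((∑ i ∈ s, x i) / (1 - M))) ≤ ∏ i ∈ s, (1 - x i) := by
  rw [Finset.sum_div, ← Finset.sum_neg_distrib, Real.exp_sum]
  refine Finset.prod_le_prod (fun i _ => (Real.exp_pos _).le) fun i hi => ?_
  have hx : 0 < 1 - x i := by linarith [h1 i hi]
  -- `log (1 / (1 - x)) ≤ 1 / (1 - x) - 1 = x / (1 - x)`
  have h2 : x i / (1 - x i) ≤ x i / (1 - M) :=
    div_le_div_of_nonneg_left (h0 i hi) (by linarith) (by linarith [h1 i hi])
  have h3 : (1 - x i)⁻¹ ≤ Real.exp (x i / (1 - M)) := by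
    refine le_trans ?_ (Real.exp_le_exp.2 h2)
    refine le_trans (le_of_eq ?_) (Real.add_one_le_exp _)
    field_simp
    ring
  rw [Real.exp_neg]
  exact inv_le_of_inv_le₀ hx h3

/-- The unnormalized Poisson weight `exp (-l) * l ^ k`. -/
noncomputable def poissonTerm (k : ℕ) (l : ℝ) : ℝ := Real.exp (-l) * l ^ k

lemma poissonTerm_nonneg (k : ℕ) {l : ℝ} (hl : 0 ≤ l) : 0 ≤ poissonTerm k l :=
  mul_nonneg (Real.exp_pos _).le (pow_nonneg hl k)

lemma poissonTerm_antitone {k : ℕ} {a b : ℝ} (ha : 0 < a) (hk : k ≤ a) (hab : a ≤ b) :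
    poissonTerm k b ≤ poissonTerm k a := by
  have h1 : b / a ≤ Real.exp (b / a - 1) := by linarith [Real.add_one_le_exp (b / a - 1)]
  have h2 : (b / a) ^ k ≤ Real.exp (b - a) := by
    refine (pow_le_pow_left₀ (div_nonneg (ha.le.trans hab) ha.le) h1 k).trans ?_
    rw [← Real.exp_nat_mul]
    refine Real.exp_le_exp.2 ?_
    have h3 : b / a - 1 = (b - a) / a := by field_simp
    rw [h3, mul_div_assoc', div_le_iff₀ ha]
    nlinarith
  unfold poissonTerm
  have h3 : b ^ k = (b / a) ^ k * a ^ k := by rw [div_pow, div_mul_cancel₀ _ (by positivity)]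
  have h4 : Real.exp (-a) = Real.exp (-b) * Real.exp (b - a) := by
    rw [← Real.exp_add]; ring_nf
  rw [h3, h4, mul_assoc]
  gcongr

lemma tendsto_poissonTerm (k : ℕ) : Tendsto (poissonTerm k) atTop (𝓝 0) := by
  refine (Real.tendsto_pow_mul_exp_neg_atTop_nhds_zero k).congr fun x => ?_
  rw [poissonTerm, mul_comm]

/-- The probability that a Poisson variable with mean `l` is less than `m`. -/
noncomputable def poissonBelow (m : ℕ) (l : ℝ) : ℝ :=
  ∑ k ∈ Finset.range m, poissonTerm k l / (k.factorial : ℝ)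

lemma poissonBelow_nonneg (m : ℕ) {l : ℝ} (hl : 0 ≤ l) : 0 ≤ poissonBelow m l :=
  Finset.sum_nonneg fun k _ => div_nonneg (poissonTerm_nonneg k hl) (by positivity)

lemma poissonBelow_antitone {m : ℕ} {a b : ℝ} (ha : 0 < a) (hm : m ≤ a) (hab : a ≤ b) :
    poissonBelow m b ≤ poissonBelow m a := by
  refine Finset.sum_le_sum fun k hk => ?_
  have hkm : (k : ℝ) ≤ m := by exact_mod_cast (Finset.mem_range.1 hk).le
  exact div_le_div_of_nonneg_right (poissonTerm_antitone ha (hkm.trans hm) hab) (by positivity)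

lemma tendsto_poissonBelow (m : ℕ) : Tendsto (poissonBelow m) atTop (𝓝 0) := by
  have h := tendsto_finsetSum (Finset.range m)
    fun k _ => (tendsto_poissonTerm k).div_const (k.factorial : ℝ)
  simp only [zero_div, Finset.sum_const_zero] at h
  exact h

lemma exp_mul_one_sub_poissonBelow (m : ℕ) (l : ℝ) :
    Real.exp l * (1 - poissonBelow m l) =
      Real.exp l - ∑ k ∈ Finset.range m, l ^ k / (k.factorial : ℝ) := by
  rw [mul_sub, mul_one, poissonBelow, Finset.mul_sum]
  congr 1
  refine Finset.sum_congr rfl fun k _ => ?_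
  rw [poissonTerm, mul_div_assoc', ← mul_assoc, ← Real.exp_add, add_neg_cancel, Real.exp_zero,
    one_mul]

/-! ### Comparison of sums with antiderivatives -/

lemma sum_Ico_le_sub_of_le_deriv {F : ℕ → ℝ} {G G' : ℝ → ℝ} {a n : ℕ} (han : a ≤ n)
    (hG : ∀ x : ℝ, a ≤ x → HasDerivAt G (G' x) x)
    (h : ∀ j : ℕ, a ≤ j → j < n → ∀ x : ℝ, j ≤ x → x ≤ j + 1 → F j ≤ G' x) :
    ∑ j ∈ Finset.Ico a n, F j ≤ G n - G a := by
  have h1 : ∀ j ∈ Finset.Ico a n, F j ≤ G ((j + 1 : ℕ) : ℝ) - G (j : ℝ) := by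
    intro j hj
    obtain ⟨hj1, hj2⟩ := Finset.mem_Ico.1 hj
    have hj1' : (a : ℝ) ≤ j := by exact_mod_cast hj1
    obtain ⟨x, hx, hx'⟩ := exists_hasDerivAt_eq_slope G G' (lt_add_one (j : ℝ))
      (fun x hx => (hG x (hj1'.trans hx.1)).continuousAt.continuousWithinAt)
      (fun x hx => hG x (hj1'.trans hx.1.le))
    have := h j hj1 hj2 x hx.1.le hx.2.le
    rw [hx', add_sub_cancel_left, div_one] at this
    exact_mod_cast this
  refine (Finset.sum_le_sum h1).trans (le_of_eq ?_)
  exact Finset.sum_Ico_sub (fun j : ℕ => G j) han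

lemma sub_le_sum_Ico_of_deriv_le {F : ℕ → ℝ} {G G' : ℝ → ℝ} {a n : ℕ} (han : a ≤ n)
    (hG : ∀ x : ℝ, a ≤ x → HasDerivAt G (G' x) x)
    (h : ∀ j : ℕ, a ≤ j → j < n → ∀ x : ℝ, j ≤ x → x ≤ j + 1 → G' x ≤ F (j + 1)) :
    G n - G a ≤ ∑ j ∈ Finset.Ico a n, F (j + 1) := by
  have := sum_Ico_le_sub_of_le_deriv (F := fun j => -F (j + 1)) (G := fun x => -G x)
    (G' := fun x => -G' x) han (fun x hx => (hG x hx).fun_neg)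
    (fun j h1 h2 x h3 h4 => neg_le_neg (h j h1 h2 x h3 h4))
  rw [Finset.sum_neg_distrib] at this
  linarith

/-! ### The quotient `f / f'` -/

namespace GrowthConditions

variable {f : ℝ → ℝ}

lemma quot_pos (hf : GrowthConditions f) {x : ℝ} (hx : 0 < x) : 0 < f x / deriv f x :=
  div_pos (hf.pos x hx) (hf.deriv_pos x hx)

lemma strictMonoOn (hf : GrowthConditions f) : StrictMonoOn f (Set.Ioi 0) := by
  refine strictMonoOn_of_deriv_pos (convex_Ioi 0)
    (fun x hx => (hf.diff_one x hx).continuousAt.continuousWithinAt) fun x hx => ?_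
  rw [interior_Ioi] at hx
  exact hf.deriv_pos x hx

lemma le_of_le (hf : GrowthConditions f) {x y : ℝ} (hx : 0 < x) (hxy : x ≤ y) : f x ≤ f y :=
  hf.strictMonoOn.monotoneOn hx (hx.trans_le hxy) hxy

/-- The second-order condition says that `f / f'` has bounded derivative near infinity. -/
lemma exists_quot_hasDerivAt (hf : GrowthConditions f) :
    ∃ K : ℝ, 0 ≤ K ∧ ∃ a : ℕ, 1 ≤ a ∧ ∀ x : ℝ, a ≤ x → ∃ g' : ℝ, |g'| ≤ K ∧
      HasDerivAt (fun x => f x / deriv f x) g' x := by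
  obtain ⟨C, hC⟩ := hf.second_order.bound
  obtain ⟨x0, hx0⟩ := eventually_atTop.1 hC
  obtain ⟨a, ha⟩ := exists_nat_ge x0
  have hC0 : 0 ≤ C := by
    have := hx0 x0 le_rfl
    rw [norm_one, mul_one] at this
    exact (norm_nonneg _).trans this
  refine ⟨1 + C, by linarith, a + 1, by omega, fun x hx => ?_⟩
  push_cast at hx
  have hxpos : 0 < x := lt_of_lt_of_le (by positivity) hx
  have h1 := hx0 x (by linarith)
  rw [norm_one, mul_one, Real.norm_eq_abs] at h1
  have hd := hf.deriv_pos x hxpos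
  have hp := hf.pos x hxpos
  refine ⟨_, ?_, (hf.diff_one x hxpos).hasDerivAt.div (hf.diff_two x hxpos).hasDerivAt hd.ne'⟩
  have : (deriv f x * deriv f x - f x * deriv (deriv f) x) / deriv f x ^ 2
      = 1 - (deriv (deriv f) x / deriv f x) / (deriv f x / f x) := by
    field_simp
  rw [this]
  refine (abs_sub _ _).trans ?_
  rw [abs_one]
  linarith

/-- Since `d log (f / f') / d log f` is the derivative of `f / f'`, which is bounded by `K`, the
quotient `f / f'` varies at most like the `K`-th power of `f`. -/
lemma quot_compare (hf : GrowthConditions f) {K : ℝ} {a : ℕ} (ha : 1 ≤ a)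
    (hK : ∀ x : ℝ, a ≤ x → ∃ g' : ℝ, |g'| ≤ K ∧ HasDerivAt (fun x => f x / deriv f x) g' x)
    (hK0 : 0 ≤ K) {x y : ℝ} (hx : a ≤ x) (hxy : x ≤ y) :
    f x / deriv f x ≤ f y / deriv f y * Real.exp (K * (f y / f x - 1)) ∧
    f y / deriv f y ≤ f x / deriv f x * Real.exp (K * (f y / f x - 1)) := by
  have ha' : (1 : ℝ) ≤ a := by exact_mod_cast ha
  have hmono : ∀ e : ℝ, |e| = 1 → MonotoneOn
      (fun x => e * Real.log (f x / deriv f x) + K * Real.log (f x)) (Set.Ici (a : ℝ)) := by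
    intro e he
    have hd : ∀ x : ℝ, a ≤ x → ∃ d, 0 ≤ d ∧ HasDerivAt
        (fun x => e * Real.log (f x / deriv f x) + K * Real.log (f x)) d x := by
      intro x hx
      obtain ⟨g', hg', hd⟩ := hK x hx
      have hx0 : 0 < x := by linarith
      have hp := hf.pos x hx0
      have hq := hf.quot_pos hx0
      have hdp := hf.deriv_pos x hx0
      refine ⟨_, ?_, ((hd.log hq.ne').const_mul e).add
        (((hf.diff_one x hx0).hasDerivAt.log hp.ne').const_mul K)⟩
      have h1 : e * (g' / (f x / deriv f x)) + K * (deriv f x / f x)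
          = (e * g' + K) * (deriv f x / f x) := by field_simp
      rw [h1]
      refine mul_nonneg ?_ (div_pos hdp hp).le
      have : |e * g'| ≤ K := by rw [abs_mul, he, one_mul]; exact hg'
      linarith [neg_abs_le (e * g')]
    refine monotoneOn_of_deriv_nonneg (convex_Ici _) (fun x hx => ?_) (fun x hx => ?_)
      (fun x hx => ?_)
    · obtain ⟨d, _, h⟩ := hd x hx
      exact h.continuousAt.continuousWithinAt
    · rw [interior_Ici] at hx
      obtain ⟨d, _, h⟩ := hd x (le_of_lt hx)
      exact h.differentiableAt.differentiableWithinAt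
    · rw [interior_Ici] at hx
      obtain ⟨d, h0, h⟩ := hd x (le_of_lt hx)
      rwa [h.deriv]
  have hx0 : 0 < x := by linarith
  have hy0 : 0 < y := by linarith
  have hfx := hf.pos x hx0
  have hfy := hf.pos y hy0
  have hlog : K * (Real.log (f y) - Real.log (f x)) ≤ K * (f y / f x - 1) := by
    rw [← Real.log_div hfy.ne' hfx.ne']
    exact mul_le_mul_of_nonneg_left (Real.log_le_sub_one_of_pos (div_pos hfy hfx)) hK0
  have h1 := hmono 1 (by simp) hx (hx.trans hxy) hxy
  have h2 := hmono (-1) (by simp) hx (hx.trans hxy) hxy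
  simp only at h1 h2
  have key : ∀ u v w : ℝ, 0 < u → 0 < v → Real.log u ≤ Real.log v + w → u ≤ v * Real.exp w := by
    intro u v w hu hv h
    rw [← Real.exp_log hu, ← Real.exp_log hv, ← Real.exp_add]
    exact Real.exp_le_exp.2 h
  exact ⟨key _ _ _ (hf.quot_pos hx0) (hf.quot_pos hy0) (by linarith),
    key _ _ _ (hf.quot_pos hy0) (hf.quot_pos hx0) (by linarith)⟩

lemma tendsto_quot (hf : GrowthConditions f) :
    Tendsto (fun x => f x / deriv f x) atTop atTop := by
  have h : Tendsto (fun x => (deriv f x / f x)⁻¹) atTop atTop := by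
    refine (tendsto_nhdsWithin_iff.2 ⟨hf.log_deriv, ?_⟩).inv_tendsto_nhdsGT_zero
    filter_upwards [eventually_gt_atTop 0] with x hx
    exact div_pos (hf.deriv_pos x hx) (hf.pos x hx)
  exact h.congr fun x => inv_div _ _

lemma tendsto_rho (hf : GrowthConditions f) : Tendsto (rho f) atTop atTop :=
  Real.tendsto_log_atTop.comp (hf.tendsto_quot.comp tendsto_natCast_atTop_atTop)

/-- As `f / f'` grows at most linearly, `ρ(N) = O(log N)`. -/
lemma tendsto_rho_div (hf : GrowthConditions f) :
    Tendsto (fun n : ℕ => rho f n / n) atTop (𝓝 0) := by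
  obtain ⟨K, hK0, a, ha, hK⟩ := hf.exists_quot_hasDerivAt
  have ha0 : (0 : ℝ) < a := by exact_mod_cast ha
  set g : ℝ → ℝ := fun x => f x / deriv f x with hg
  have hga : 0 < g a := hf.quot_pos ha0
  have hb : ∀ x : ℝ, a ≤ x → g x ≤ (g a + K) * x := by
    intro x hx
    have h := (convex_Ici (a : ℝ)).norm_image_sub_le_of_norm_deriv_le (f := g) (C := K)
      (fun z hz => (hK z hz).choose_spec.2.differentiableAt)
      (fun z hz => by
        rw [(hK z hz).choose_spec.2.deriv]; exact (hK z hz).choose_spec.1)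
      (Set.self_mem_Ici) (Set.mem_Ici.2 hx)
    rw [Real.norm_eq_abs, Real.norm_eq_abs, abs_of_nonneg (sub_nonneg.2 hx)] at h
    have h1 := (le_abs_self _).trans h
    have ha1 : (1 : ℝ) ≤ a := by exact_mod_cast ha
    nlinarith
  have hlog : Tendsto (fun n : ℕ => Real.log (g a + K) / n + Real.log n / n) atTop (𝓝 0) := by
    have h1 : Tendsto (fun n : ℕ => Real.log (g a + K) / n) atTop (𝓝 0) :=
      tendsto_const_nhds.div_atTop tendsto_natCast_atTop_atTop
    have h2 : Tendsto (fun n : ℕ => Real.log n / n) atTop (𝓝 0) :=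
      (Real.isLittleO_log_id_atTop.tendsto_div_nhds_zero).comp tendsto_natCast_atTop_atTop
    simpa using h1.add h2
  refine tendsto_of_tendsto_of_tendsto_of_le_of_le' tendsto_const_nhds hlog ?_ ?_
  · filter_upwards [hf.tendsto_rho.eventually_ge_atTop 0] with n hn
    positivity
  · filter_upwards [eventually_ge_atTop a] with n hn
    have hn' : (a : ℝ) ≤ n := by exact_mod_cast hn
    have hn0 : (0 : ℝ) < n := by linarith
    rw [← add_div, ← Real.log_mul (by linarith) hn0.ne']
    gcongr
    exact Real.log_le_log (hf.quot_pos hn0) (hb n hn')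

/-! ### The sum of the Poisson terms -/

/-- The explicit antiderivatives for the sums, with `v = f y / f x` and `v' = -v / (f / f')`. -/
lemma hasDerivAt_exp_ratio (hf : GrowthConditions f) (c r d y : ℝ) (hr : r ≠ 0) {x : ℝ}
    (hx : 0 < x) :
    HasDerivAt (fun x => c * Real.exp (-(r * (f y / f x)) + d) / r)
      (c * Real.exp (-(r * (f y / f x)) + d) * (f y / f x) / (f x / deriv f x)) x := by
  have hp := hf.pos x hx
  have hd := hf.deriv_pos x hx
  have h1 : HasDerivAt (fun x => f y / f x) (-(f y * deriv f x) / f x ^ 2) x := by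
    simpa using (hasDerivAt_const x (f y)).fun_div (hf.diff_one x hx).hasDerivAt hp.ne'
  have h2 := ((((h1.const_mul r).neg.add_const d).exp).const_mul c).div_const r
  convert! h2 using 1
  simp only [Pi.neg_apply]
  field_simp

/-- The upper half of the estimate of the sum. The antiderivative for the comparison is
`f n / f' n * s ^ k * exp (-s v + (K + k) (v - 1)) / (s - (K + k))`, where `v = f n / f x`: the
extra exponent absorbs both the factor `v ^ k` and the variation of `f / f'`. -/
lemma sum_poissonTerm_le (hf : GrowthConditions f) {K : ℝ} {a : ℕ} (ha : 1 ≤ a)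
    (hK : ∀ x : ℝ, a ≤ x → ∃ g' : ℝ, |g'| ≤ K ∧ HasDerivAt (fun x => f x / deriv f x) g' x)
    (hK0 : 0 ≤ K) {k n : ℕ} {s : ℝ} (hs : K + k < s) (han : a ≤ n) :
    ∑ j ∈ Finset.Ico a n, poissonTerm k (s * (f n / f j)) ≤
      f n / deriv f n * s ^ k * Real.exp (-s) / (s - (K + k)) := by
  have ha' : (1 : ℝ) ≤ a := by exact_mod_cast ha
  have hk0 : (0 : ℝ) ≤ k := k.cast_nonneg
  have hs0 : 0 < s := by linarith
  have hn0 : (0 : ℝ) < n := by exact_mod_cast ha.trans han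
  have hfn := hf.pos n hn0
  have hgn := hf.quot_pos hn0
  set r := s - (K + k) with hr
  have hr0 : 0 < r := by linarith
  have hG : ∀ x : ℝ, a ≤ x → HasDerivAt _ _ x := fun x hx =>
    hf.hasDerivAt_exp_ratio (f n / deriv f n * s ^ k) r (-(K + k)) n hr0.ne'
      (show 0 < x by linarith)
  have h := sum_Ico_le_sub_of_le_deriv (F := fun j => poissonTerm k (s * (f n / f j))) han hG ?_
  · refine h.trans ((sub_le_self _ (by positivity)).trans (le_of_eq ?_))
    rw [div_self hfn.ne', mul_one, hr]
    ring_nf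
  · intro j hj hjn x hx1 hx2
    have hj' : (a : ℝ) ≤ j := by exact_mod_cast hj
    have hjn' : (j : ℝ) + 1 ≤ n := by exact_mod_cast hjn
    have hx0 : 0 < x := by linarith
    have hfx := hf.pos x hx0
    have hgx := hf.quot_pos hx0
    set v := f n / f x with hv
    have hv1 : 1 ≤ v := by
      rw [hv, one_le_div hfx]
      exact hf.le_of_le hx0 (by linarith)
    have hcmp := (hf.quot_compare ha hK hK0 (hj'.trans hx1) (show x ≤ n by linarith)).1
    have hvk : v ^ k ≤ Real.exp (k * (v - 1)) := by
      rw [Real.exp_nat_mul]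
      exact pow_le_pow_left₀ (by linarith) (by linarith [Real.add_one_le_exp (v - 1)]) k
    calc poissonTerm k (s * (f n / f j)) ≤ poissonTerm k (s * v) := by
          have hle : v ≤ f n / f j :=
            div_le_div_of_nonneg_left hfn.le (hf.pos j (by linarith))
              (hf.le_of_le (by linarith) hx1)
          refine poissonTerm_antitone (by positivity) ?_ (by gcongr)
          nlinarith
      _ = s ^ k * (Real.exp (-(s * v)) * v ^ k) := by rw [poissonTerm, mul_pow]; ring
      _ ≤ s ^ k * (Real.exp (-(s * v)) * Real.exp (k * (v - 1)) * v) := by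
          have : v ^ k ≤ Real.exp (k * (v - 1)) * v :=
            hvk.trans (le_mul_of_one_le_right (Real.exp_pos _).le hv1)
          rw [mul_assoc]
          gcongr
      _ ≤ f n / deriv f n * s ^ k * Real.exp (-(r * v) + -(K + k)) * v / (f x / deriv f x) := by
          rw [le_div_iff₀ hgx]
          have he : Real.exp (-(r * v) + -(K + k)) =
              Real.exp (-(s * v)) * Real.exp (k * (v - 1)) * Real.exp (K * (v - 1)) := by
            rw [← Real.exp_add, ← Real.exp_add, hr]; ring_nf
          rw [he]
          calc _ ≤ s ^ k * (Real.exp (-(s * v)) * Real.exp (k * (v - 1)) * v) *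
                (f n / deriv f n * Real.exp (K * (v - 1))) := by gcongr
            _ = _ := by ring

/-- The lower half of the estimate of the sum, with the extra exponent `-(K + 1) (v - 1)`. The
summand `1` in `K + 1` absorbs the factor `v` that comes from the derivative of `f n / f x`; it is
needed only for `k = 0`. -/
lemma le_sum_poissonTerm (hf : GrowthConditions f) {K : ℝ} {a : ℕ} (ha : 1 ≤ a)
    (hK : ∀ x : ℝ, a ≤ x → ∃ g' : ℝ, |g'| ≤ K ∧ HasDerivAt (fun x => f x / deriv f x) g' x)
    (hK0 : 0 ≤ K) {k n : ℕ} {s : ℝ} (hs0 : 0 < s) (hs : k ≤ s) (han : a ≤ n) :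
    f n / deriv f n * s ^ k * Real.exp (-s) / (s + (K + 1)) *
        (1 - Real.exp (-((s + (K + 1)) * (f n / f a - 1)))) ≤
      ∑ j ∈ Finset.Ico a n, poissonTerm k (s * (f n / f (j + 1 : ℕ))) := by
  have ha' : (1 : ℝ) ≤ a := by exact_mod_cast ha
  have hn0 : (0 : ℝ) < n := by exact_mod_cast ha.trans han
  have hfn := hf.pos n hn0
  have hgn := hf.quot_pos hn0
  set r := s + (K + 1) with hr
  have hr0 : 0 < r := by linarith
  have hG : ∀ x : ℝ, a ≤ x → HasDerivAt _ _ x := fun x hx =>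
    hf.hasDerivAt_exp_ratio (f n / deriv f n * s ^ k) r (K + 1) n hr0.ne'
      (show 0 < x by linarith)
  have h := sub_le_sum_Ico_of_deriv_le (F := fun j => poissonTerm k (s * (f n / f j))) han hG ?_
  · refine le_trans (le_of_eq ?_) h
    have e1 : Real.exp (-(r * (f n / f n)) + (K + 1)) = Real.exp (-s) := by
      rw [div_self hfn.ne', hr]; ring_nf
    have e2 : Real.exp (-(r * (f n / f a)) + (K + 1)) =
        Real.exp (-s) * Real.exp (-(r * (f n / f a - 1))) := by
      rw [← Real.exp_add, hr]; ring_nf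
    rw [e1, e2]
    ring
  · intro j hj hjn x hx1 hx2
    have hj' : (a : ℝ) ≤ j := by exact_mod_cast hj
    have hjn' : (j : ℝ) + 1 ≤ n := by exact_mod_cast hjn
    have hx0 : 0 < x := by linarith
    have hfx := hf.pos x hx0
    have hgx := hf.quot_pos hx0
    have hfj : 0 < f ((j + 1 : ℕ) : ℝ) := hf.pos _ (by push_cast; linarith)
    set v := f n / f x with hv
    have hle : f n / f (j + 1 : ℕ) ≤ v :=
      div_le_div_of_nonneg_left hfn.le hfx (hf.le_of_le hx0 (by push_cast; exact hx2))
    have hj1 : 1 ≤ f n / f (j + 1 : ℕ) := by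
      rw [one_le_div hfj]
      exact hf.le_of_le (by push_cast; linarith) (by push_cast; exact hjn')
    have hv1 : 1 ≤ v := hj1.trans hle
    have hcmp := (hf.quot_compare ha hK hK0 (hj'.trans hx1) (show x ≤ n by linarith)).2
    have hvk : v ≤ v ^ k * Real.exp (v - 1) := by
      have h1 : v ≤ Real.exp (v - 1) := by linarith [Real.add_one_le_exp (v - 1)]
      exact h1.trans (le_mul_of_one_le_left (Real.exp_pos _).le (one_le_pow₀ hv1))
    calc f n / deriv f n * s ^ k * Real.exp (-(r * v) + (K + 1)) * v / (f x / deriv f x)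
        ≤ s ^ k * (Real.exp (-(s * v)) * v ^ k) := by
          rw [div_le_iff₀ hgx]
          have he : Real.exp (-(s * v)) = Real.exp (-(r * v) + (K + 1)) * Real.exp (v - 1) *
              Real.exp (K * (v - 1)) := by
            rw [← Real.exp_add, ← Real.exp_add, hr]; ring_nf
          rw [he]
          calc _ ≤ (f x / deriv f x * Real.exp (K * (v - 1))) * s ^ k *
                Real.exp (-(r * v) + (K + 1)) * (v ^ k * Real.exp (v - 1)) := by gcongr
            _ = _ := by ring
      _ = poissonTerm k (s * v) := by rw [poissonTerm, mul_pow]; ring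
      _ ≤ poissonTerm k (s * (f n / f (j + 1 : ℕ))) := by
          refine poissonTerm_antitone (by positivity) ?_ (by gcongr)
          nlinarith

lemma one_le_ratio (hf : GrowthConditions f) {n j : ℕ} (hj : j ∈ Finset.Icc 1 n) :
    1 ≤ f n / f j := by
  obtain ⟨h1, h2⟩ := Finset.mem_Icc.1 hj
  have h1' : (1 : ℝ) ≤ j := by exact_mod_cast h1
  rw [one_le_div (hf.pos _ (by linarith))]
  exact hf.le_of_le (by linarith) (by exact_mod_cast h2)

lemma tendsto_ratio (hf : GrowthConditions f) {a : ℕ} (ha : 1 ≤ a) :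
    Tendsto (fun n : ℕ => f n / f a) atTop atTop :=
  (hf.tendsto_atTop.comp tendsto_natCast_atTop_atTop).atTop_div_const
    (hf.pos _ (by exact_mod_cast ha))

/-- Laplace's method: the sum is governed by the types `j` with `f n / f j = 1 + O(1 / s n)`, where
`f / f'` is nearly constant. -/
lemma tendsto_sum_poissonTerm (hf : GrowthConditions f) {s : ℕ → ℝ} (hs : Tendsto s atTop atTop)
    {k : ℕ} {L : ℝ} (hL : Tendsto (fun n : ℕ =>
      f n / deriv f n * s n ^ k * Real.exp (-s n) / s n) atTop (𝓝 L)) :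
    Tendsto (fun n : ℕ => ∑ j ∈ Finset.Icc 1 n, poissonTerm k (s n * (f n / f j)))
      atTop (𝓝 L) := by
  obtain ⟨K, hK0, a, ha, hK⟩ := hf.exists_quot_hasDerivAt
  have hratio : ∀ d : ℝ, Tendsto (fun n => s n / (s n + d)) atTop (𝓝 1) := by
    intro d
    have h1 : Tendsto (fun n => 1 - d / (s n + d)) atTop (𝓝 (1 - 0)) :=
      tendsto_const_nhds.sub
        (tendsto_const_nhds.div_atTop (tendsto_atTop_add_const_right _ d hs))
    rw [sub_zero] at h1
    refine h1.congr' ?_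
    filter_upwards [hs.eventually_gt_atTop (-d)] with n hn
    have : s n + d ≠ 0 := by linarith
    field_simp
    ring
  have hlow : Tendsto (fun n : ℕ =>
      f n / deriv f n * s n ^ k * Real.exp (-s n) / (s n + (K + 1)) *
        (1 - Real.exp (-((s n + (K + 1)) * (f n / f a - 1))))) atTop (𝓝 L) := by
    have h1 := hL.mul (hratio (K + 1))
    have h2 : Tendsto (fun n : ℕ => (s n + (K + 1)) * (f n / f a - 1)) atTop atTop :=
      (tendsto_atTop_add_const_right _ _ hs).atTop_mul_atTop₀
        (tendsto_atTop_add_const_right _ (-1) (hf.tendsto_ratio ha))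
    have h3 := h1.mul ((Real.tendsto_exp_neg_atTop_nhds_zero.comp h2).const_sub 1)
    rw [mul_one, sub_zero, mul_one] at h3
    refine h3.congr' ?_
    filter_upwards [hs.eventually_gt_atTop 0] with n hn
    simp only [Function.comp_apply]
    congr 1
    field_simp
  have hupp : Tendsto (fun n : ℕ =>
      (∑ j ∈ Finset.Ico 1 a, poissonTerm k (s n * (f n / f j))) +
      (f n / deriv f n * s n ^ k * Real.exp (-s n) / (s n - (K + k)) + poissonTerm k (s n)))
      atTop (𝓝 L) := by
    have h1 : Tendsto (fun n : ℕ => ∑ j ∈ Finset.Ico 1 a, poissonTerm k (s n * (f n / f j)))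
        atTop (𝓝 0) := by
      rw [← Finset.sum_const_zero (s := Finset.Ico 1 a)]
      refine tendsto_finsetSum _ fun j hj => (tendsto_poissonTerm k).comp ?_
      exact hs.atTop_mul_atTop₀ (hf.tendsto_ratio (Finset.mem_Ico.1 hj).1)
    have h2 := hL.mul (hratio (-(K + k)))
    have h3 := h1.add (h2.add ((tendsto_poissonTerm k).comp hs))
    rw [mul_one, add_zero, zero_add] at h3
    refine h3.congr' ?_
    filter_upwards [hs.eventually_gt_atTop 0] with n hn
    simp only [Function.comp_apply]
    congr 2
    rw [← sub_eq_add_neg]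
    field_simp
  -- The types below `a`, where the derivative bound is not available, and the last type `n` are
  -- negligible.
  refine tendsto_of_tendsto_of_tendsto_of_le_of_le' hlow hupp ?_ ?_
  · filter_upwards [hs.eventually_gt_atTop 0, hs.eventually_ge_atTop (k : ℝ),
      eventually_ge_atTop a] with n h0 hk han
    refine (hf.le_sum_poissonTerm ha hK hK0 h0 hk han).trans ?_
    rw [Finset.sum_Ico_add' (fun j : ℕ => poissonTerm k (s n * (f n / f j))) a n 1]
    refine Finset.sum_le_sum_of_subset_of_nonneg ?_ ?_
    · intro j hj
      simp only [Finset.mem_Ico, Finset.mem_Icc] at hj ⊢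
      omega
    · intro j hj _
      have := hf.one_le_ratio hj
      exact poissonTerm_nonneg k (by positivity)
  · filter_upwards [hs.eventually_gt_atTop (K + k), eventually_ge_atTop a] with n hk han
    have h := hf.sum_poissonTerm_le ha hK hK0 hk han
    have hn0 : (0 : ℝ) < n := by exact_mod_cast ha.trans han
    have hsplit : Finset.Icc 1 n = Finset.Ico 1 (n + 1) := by ext; simp
    rw [hsplit, Finset.sum_Ico_succ_top (ha.trans han), div_self (hf.pos n hn0).ne', mul_one,
      ← Finset.sum_Ico_consecutive _ ha han]
    linarith

end GrowthConditions

/-! ### The limit at the Poissonized time -/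

/-- The normalized time `s = ρ(N) + (m - 2) ln ρ(N) + y`, so that `b_N + k_N y = k_N s`. -/
noncomputable def normTime (f : ℝ → ℝ) (m : ℕ) (y : ℝ) (n : ℕ) : ℝ :=
  rho f n + ((m : ℝ) - 2) * Real.log (rho f n) + y

namespace GrowthConditions

variable {f : ℝ → ℝ}

lemma tendsto_normTime_div_rho (hf : GrowthConditions f) (m : ℕ) (y : ℝ) :
    Tendsto (fun n => normTime f m y n / rho f n) atTop (𝓝 1) := by
  have h1 : Tendsto (fun x : ℝ => 1 + ((m : ℝ) - 2) * (Real.log x / x) + y / x) atTop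
      (𝓝 (1 + ((m : ℝ) - 2) * 0 + 0)) :=
    (tendsto_const_nhds.add
      ((Real.isLittleO_log_id_atTop.tendsto_div_nhds_zero).const_mul _)).add
      (tendsto_const_nhds.div_atTop tendsto_id)
  rw [mul_zero, add_zero, add_zero] at h1
  refine (h1.comp hf.tendsto_rho).congr' ?_
  filter_upwards [hf.tendsto_rho.eventually_gt_atTop 0] with n hn
  simp only [Function.comp_apply, normTime]
  field_simp

lemma tendsto_normTime (hf : GrowthConditions f) (m : ℕ) (y : ℝ) :
    Tendsto (normTime f m y) atTop atTop := by
  refine ((hf.tendsto_normTime_div_rho m y).pos_mul_atTop one_pos hf.tendsto_rho).congr' ?_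
  filter_upwards [hf.tendsto_rho.eventually_gt_atTop 0] with n hn
  exact div_mul_cancel₀ _ hn.ne'

/-- With `s = normTime f m y n`, `exp (-s) = exp (-ρ) ρ ^ (2 - m) exp (-y)` and `f / f' = exp ρ`,
so that the expression is asymptotic to `ρ ^ (k + 1 - m) exp (-y)`. -/
lemma tendsto_mass (hf : GrowthConditions f) {m k : ℕ} (hk : k < m) (y : ℝ) :
    Tendsto (fun n : ℕ => f n / deriv f n * normTime f m y n ^ k *
      Real.exp (-normTime f m y n) / normTime f m y n) atTop
      (𝓝 (if k = m - 1 then Real.exp (-y) else 0)) := by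
  obtain ⟨M, rfl⟩ : ∃ M, m = M + 1 := ⟨m - 1, by omega⟩
  rw [Nat.add_sub_cancel]
  have hr := hf.tendsto_normTime_div_rho (M + 1) y
  have hpow : Tendsto (fun n : ℕ => rho f n ^ k / rho f n ^ M) atTop
      (𝓝 (if k = M then 1 else 0)) := by
    split_ifs with h
    · subst h
      refine tendsto_const_nhds.congr' ?_
      filter_upwards [hf.tendsto_rho.eventually_gt_atTop 0] with n hn
      rw [div_self (by positivity)]
    · exact (tendsto_pow_div_pow_atTop_zero (𝕜 := ℝ) (by omega)).comp hf.tendsto_rho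
  have h := ((hr.pow k).div hr one_ne_zero).mul (hpow.const_mul (Real.exp (-y)))
  have he : (1 : ℝ) ^ k / 1 * (Real.exp (-y) * if k = M then 1 else 0) =
      if k = M then Real.exp (-y) else 0 := by split_ifs <;> simp
  rw [he] at h
  refine h.congr' ?_
  filter_upwards [hf.tendsto_rho.eventually_gt_atTop 0, eventually_ge_atTop 1,
    (hf.tendsto_normTime (M + 1) y).eventually_gt_atTop 0] with n hn hn1 hs
  have hq : f n / deriv f n = Real.exp (rho f n) := by
    rw [rho, Real.exp_log (hf.quot_pos (by exact_mod_cast hn1))]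
  have hexp : Real.exp (-normTime f (M + 1) y n) =
      Real.exp (-rho f n) * (rho f n / rho f n ^ M) * Real.exp (-y) := by
    have h1 : rho f n / rho f n ^ M = Real.exp (-(((M : ℝ) - 1) * Real.log (rho f n))) := by
      rw [neg_mul_eq_neg_mul, neg_sub, sub_mul, one_mul, Real.exp_sub, Real.exp_log hn,
        Real.exp_nat_mul, Real.exp_log hn]
    rw [h1, ← Real.exp_add, ← Real.exp_add, normTime]
    push_cast
    ring_nf
  rw [hexp, hq, Real.exp_neg (rho f n)]
  have := Real.exp_pos (rho f n)
  rw [Pi.div_apply, div_pow]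
  field_simp

/-- The expected number of types drawn less than `m` times at the Poissonized time. -/
lemma tendsto_sum_poissonBelow (hf : GrowthConditions f) {m : ℕ} (hm : 1 ≤ m) (y : ℝ) :
    Tendsto (fun n : ℕ => ∑ j ∈ Finset.Icc 1 n, poissonBelow m (normTime f m y n * (f n / f j)))
      atTop (𝓝 (Real.exp (-y) / ((m - 1).factorial : ℝ))) := by
  have h : Tendsto (fun n : ℕ => ∑ k ∈ Finset.range m,
      (∑ j ∈ Finset.Icc 1 n, poissonTerm k (normTime f m y n * (f n / f j))) /
        (k.factorial : ℝ)) atTop (𝓝 (∑ k ∈ Finset.range m,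
          (if k = m - 1 then Real.exp (-y) else 0) / (k.factorial : ℝ))) :=
    tendsto_finsetSum _ fun k hk => (hf.tendsto_sum_poissonTerm (hf.tendsto_normTime m y)
      (hf.tendsto_mass (Finset.mem_range.1 hk) y)).div_const _
  have he : ∑ k ∈ Finset.range m, (if k = m - 1 then Real.exp (-y) else 0) / (k.factorial : ℝ)
      = Real.exp (-y) / ((m - 1).factorial : ℝ) := by
    rw [Finset.sum_eq_single_of_mem (m - 1) (Finset.mem_range.2 (by omega))]
    · simp
    · intro k _ hk
      simp [hk]
  rw [he] at h
  refine h.congr fun n => ?_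
  simp only [poissonBelow, Finset.sum_div]
  exact Finset.sum_comm

/-- The limit law at the Poissonized time, where the types are independent. -/
lemma tendsto_prod_one_sub_poissonBelow (hf : GrowthConditions f) {m : ℕ} (hm : 1 ≤ m) (y : ℝ) :
    Tendsto (fun n : ℕ => ∏ j ∈ Finset.Icc 1 n,
      (1 - poissonBelow m (normTime f m y n * (f n / f j)))) atTop (𝓝 (limitCDF m y)) := by
  have hS := hf.tendsto_sum_poissonBelow hm y
  have hs := hf.tendsto_normTime m y
  have hM : Tendsto (fun n => poissonBelow m (normTime f m y n)) atTop (𝓝 0) :=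
    (tendsto_poissonBelow m).comp hs
  have hlow : Tendsto (fun n : ℕ => Real.exp (-((∑ j ∈ Finset.Icc 1 n,
      poissonBelow m (normTime f m y n * (f n / f j))) /
        (1 - poissonBelow m (normTime f m y n))))) atTop (𝓝 (limitCDF m y)) := by
    have h := hS.div (hM.const_sub 1) (by norm_num)
    rw [sub_zero, div_one] at h
    exact (Real.continuous_exp.tendsto _).comp h.neg
  have hupp : Tendsto (fun n : ℕ => Real.exp (-∑ j ∈ Finset.Icc 1 n,
      poissonBelow m (normTime f m y n * (f n / f j)))) atTop (𝓝 (limitCDF m y)) :=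
    (Real.continuous_exp.tendsto _).comp hS.neg
  have hev : ∀ᶠ n : ℕ in atTop, poissonBelow m (normTime f m y n) < 1 ∧
      ∀ j ∈ Finset.Icc 1 n, 0 ≤ poissonBelow m (normTime f m y n * (f n / f j)) ∧
        poissonBelow m (normTime f m y n * (f n / f j)) ≤
          poissonBelow m (normTime f m y n) := by
    filter_upwards [hM.eventually_lt_const one_pos, hs.eventually_ge_atTop (m : ℝ),
      hs.eventually_gt_atTop 0] with n h1 h2 h3
    refine ⟨h1, fun j hj => ?_⟩
    have hr := hf.one_le_ratio hj
    exact ⟨poissonBelow_nonneg m (by positivity),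
      poissonBelow_antitone h3 h2 (le_mul_of_one_le_right h3.le hr)⟩
  refine tendsto_of_tendsto_of_tendsto_of_le_of_le' hlow hupp ?_ ?_
  · filter_upwards [hev] with n hn
    exact exp_le_prod_one_sub _ _ hn.1 (fun j hj => (hn.2 j hj).1) fun j hj => (hn.2 j hj).2
  · filter_upwards [hev] with n hn
    exact prod_one_sub_le_exp _ _ fun j hj => (hn.2 j hj).2.trans hn.1.le

end GrowthConditions

/-! ### The limit law -/

lemma continuous_limitCDF (m : ℕ) : Continuous (limitCDF m) := by
  unfold limitCDF
  fun_prop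

lemma monotone_limitCDF (m : ℕ) : Monotone (limitCDF m) := fun a b hab => by
  unfold limitCDF
  gcongr

lemma exists_cdf_eq_limitCDF (m : ℕ) :
    ∃ μ : Measure ℝ, IsProbabilityMeasure μ ∧ ∀ y : ℝ, cdf μ y = limitCDF m y := by
  let F : StieltjesFunction ℝ :=
    { toFun := limitCDF m
      mono' := monotone_limitCDF m
      right_continuous' := fun x => (continuous_limitCDF m).continuousWithinAt }
  have hfac : (0 : ℝ) < ((m - 1).factorial : ℝ) := by exact_mod_cast (m - 1).factorial_pos
  have h0 : Tendsto F atBot (𝓝 0) := by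
    have h1 : Tendsto (fun y : ℝ => Real.exp (-y) / ((m - 1).factorial : ℝ)) atBot atTop :=
      (Real.tendsto_exp_atTop.comp tendsto_neg_atBot_atTop).atTop_div_const hfac
    exact Real.tendsto_exp_neg_atTop_nhds_zero.comp h1
  have h1 : Tendsto F atTop (𝓝 1) := by
    have h1 : Tendsto (fun y : ℝ => -(Real.exp (-y) / ((m - 1).factorial : ℝ))) atTop (𝓝 0) := by
      simpa using (Real.tendsto_exp_neg_atTop_nhds_zero.div_const
        ((m - 1).factorial : ℝ)).neg
    have h2 := (Real.continuous_exp.tendsto 0).comp h1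
    rw [Real.exp_zero] at h2
    exact h2
  refine ⟨F.measure, F.isProbabilityMeasure h0 h1, fun y => ?_⟩
  rw [cdf_measure_stieltjesFunction F h0 h1]

/-! ### The collection time -/

lemma collectionTime_le_iff {Ω : Type*} (X : ℕ → Ω → ℕ) (m N n : ℕ) (ω : Ω) :
    collectionTime X m N ω ≤ (n : ℕ∞) ↔ ω ∈ allCounts X N (fun _ => m) n := by
  constructor
  · intro h
    have hne : {t : ℕ∞ | ∃ n : ℕ, t = n ∧
        ∀ j ∈ Finset.Icc 1 N, m ≤ count X j n ω}.Nonempty := by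
      by_contra hempty
      rw [collectionTime, Set.not_nonempty_iff_eq_empty.1 hempty, sInf_empty, top_le_iff] at h
      exact ENat.natCast_ne_top n h
    obtain ⟨k, hk, hk'⟩ := csInf_mem hne
    have hkn : k ≤ n := by
      rw [collectionTime, hk] at h
      exact_mod_cast h
    exact allCounts_mono X N (fun _ => m) hkn hk'
  · exact fun h => sInf_le ⟨n, rfl, h⟩

lemma normalizedTime_le_iff {Ω : Type*} {f : ℝ → ℝ} (X : ℕ → Ω → ℕ) (m N : ℕ) (ω : Ω) {y : ℝ}
    (hk : 0 < scaling f N) (hy : 0 ≤ centering f m N + scaling f N * y) :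
    normalizedTime f X m N ω ≤ (y : EReal) ↔
      ω ∈ allCounts X N (fun _ => m) ⌊centering f m N + scaling f N * y⌋₊ := by
  rw [← collectionTime_le_iff, normalizedTime]
  cases h : collectionTime X m N ω with
  | top =>
    have h1 : (((⊤ : ℕ∞) : ℝ≥0∞) : EReal) - (centering f m N : EReal) = ⊤ := by
      simp
    rw [h1, EReal.top_div_of_pos_ne_top (by exact_mod_cast hk) (EReal.coe_ne_top _)]
    simp
  | coe t =>
    have h1 : ((((t : ℕ∞) : ℝ≥0∞) : EReal) - (centering f m N : EReal)) /
        (scaling f N : EReal) = (((t : ℝ) - centering f m N) / scaling f N : ℝ) := by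
      have h2 : (((t : ℕ∞) : ℝ≥0∞) : EReal) = ((t : ℝ) : EReal) := by
        rw [ENat.toENNReal_coe, ← ENNReal.ofReal_natCast, EReal.coe_ennreal_ofReal,
          max_eq_left t.cast_nonneg]
      rw [EReal.coe_div, EReal.coe_sub, h2]
    rw [h1, EReal.coe_le_coe_iff, div_le_iff₀ hk, Nat.cast_le, Nat.le_floor_iff hy]
    constructor <;> intro h <;> linarith

/-! ### Poissonization and depoissonization of the collection time -/

namespace GrowthConditions

variable {f : ℝ → ℝ}

lemma weight_pos (hf : GrowthConditions f) {N j : ℕ} (hj : j ∈ Finset.Icc 1 N) :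
    0 < weight f j :=
  one_div_pos.2 (hf.pos _ (by exact_mod_cast (Finset.mem_Icc.1 hj).1))

lemma weightSum_pos (hf : GrowthConditions f) {N : ℕ} (hN : 1 ≤ N) : 0 < weightSum f N :=
  Finset.sum_pos (fun _ hj => hf.weight_pos hj) ⟨1, Finset.mem_Icc.2 ⟨le_rfl, hN⟩⟩

lemma couponProb_nonneg (hf : GrowthConditions f) {N : ℕ} (hN : 1 ≤ N) :
    ∀ j ∈ Finset.Icc 1 N, 0 ≤ couponProb f N j :=
  fun _ hj => (div_pos (hf.weight_pos hj) (hf.weightSum_pos hN)).le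

lemma sum_couponProb (hf : GrowthConditions f) {N : ℕ} (hN : 1 ≤ N) :
    ∑ j ∈ Finset.Icc 1 N, couponProb f N j = 1 := by
  simp only [couponProb]
  rw [← Finset.sum_div]
  exact div_self (hf.weightSum_pos hN).ne'

lemma scaling_pos (hf : GrowthConditions f) {N : ℕ} (hN : 1 ≤ N) : 0 < scaling f N :=
  mul_pos (hf.weightSum_pos hN) (hf.pos _ (by exact_mod_cast hN))

lemma natCast_le_scaling (hf : GrowthConditions f) (N : ℕ) : (N : ℝ) ≤ scaling f N := by
  rw [scaling, weightSum, Finset.sum_mul]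
  have h : ∑ _j ∈ Finset.Icc 1 N, (1 : ℝ) ≤ ∑ j ∈ Finset.Icc 1 N, weight f j * f N :=
    Finset.sum_le_sum fun j hj => by
      rw [weight, one_div_mul_eq_div]
      exact hf.one_le_ratio hj
  simpa using h

lemma hasSum_collection (hf : GrowthConditions f) {Ω : Type*} [MeasurableSpace Ω]
    {P : Measure Ω} [IsProbabilityMeasure P] {N : ℕ} (hN : 1 ≤ N) {X : ℕ → Ω → ℕ}
    (hX : IsSampling P N (couponProb f N) X) (m : ℕ) (s : ℝ) :
    HasSum (fun n : ℕ => (scaling f N * s) ^ n / (n.factorial : ℝ) *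
        P.real (allCounts X N (fun _ => m) n))
      (Real.exp (scaling f N * s) *
        ∏ j ∈ Finset.Icc 1 N, (1 - poissonBelow m (s * (f N / f j)))) := by
  have h := hX.hasSum_real_allCounts (hf.couponProb_nonneg hN) (hf.sum_couponProb hN) m
    (scaling f N * s)
  convert! h using 1
  have h1 : Real.exp (scaling f N * s) =
      ∏ j ∈ Finset.Icc 1 N, Real.exp (couponProb f N j * (scaling f N * s)) := by
    rw [← Real.exp_sum, ← Finset.sum_mul, hf.sum_couponProb hN, one_mul]
  rw [h1, ← Finset.prod_mul_distrib]
  refine Finset.prod_congr rfl fun j hj => ?_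
  have h2 : s * (f N / f j) = couponProb f N j * (scaling f N * s) := by
    have := (hf.weightSum_pos hN).ne'
    rw [couponProb, weight, scaling]
    field_simp
  rw [h2, exp_mul_one_sub_poissonBelow]

/-- The Chebyshev error of the depoissonization, for the mean `k_N s` and the deviation `k_N d`. -/
lemma tendsto_chebyshev_error (hf : GrowthConditions f) (m : ℕ) (y : ℝ) {d : ℝ} (hd : 0 < d) :
    Tendsto (fun N : ℕ => scaling f N * normTime f m y N / (scaling f N * d) ^ 2)
      atTop (𝓝 0) := by
  have h := ((hf.tendsto_normTime_div_rho m y).mul hf.tendsto_rho_div).mul_const (1 / d ^ 2)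
  rw [mul_zero, zero_mul] at h
  refine tendsto_of_tendsto_of_tendsto_of_le_of_le' tendsto_const_nhds h ?_ ?_
  · filter_upwards [(hf.tendsto_normTime m y).eventually_gt_atTop 0, eventually_ge_atTop 1]
      with N h1 h2
    have := hf.scaling_pos h2
    positivity
  · filter_upwards [(hf.tendsto_normTime m y).eventually_gt_atTop 0, eventually_ge_atTop 1,
      hf.tendsto_rho.eventually_gt_atTop 0] with N h1 h2 h3
    have hk := hf.scaling_pos h2
    have hN : (0 : ℝ) < N := by exact_mod_cast h2
    have e1 : scaling f N * normTime f m y N / (scaling f N * d) ^ 2 =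
        normTime f m y N / scaling f N * (1 / d ^ 2) := by field_simp
    have e2 : normTime f m y N / rho f N * (rho f N / N) * (1 / d ^ 2) =
        normTime f m y N / N * (1 / d ^ 2) := by field_simp
    rw [e1, e2]
    have := hf.natCast_le_scaling N
    gcongr

end GrowthConditions

lemma centering_add_scaling_mul (f : ℝ → ℝ) (m N : ℕ) (y : ℝ) :
    centering f m N + scaling f N * y = scaling f N * normTime f m y N := by
  rw [centering, scaling, normTime]
  ring

lemma normTime_add (f : ℝ → ℝ) (m N : ℕ) (y d : ℝ) :
    normTime f m (y + d) N = normTime f m y N + d := by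
  rw [normTime, normTime]
  ring

end CouponCollector

open CouponCollector in
theorem theorem4p2 (f : ℝ → ℝ) (hf : CouponCollector.GrowthConditions f) (m : ℕ) (hm : 1 ≤ m)
    {Ω : ℕ → Type*} [∀ N, MeasurableSpace (Ω N)] (P : ∀ N, Measure (Ω N))
    [∀ N, IsProbabilityMeasure (P N)] (X : ∀ N, ℕ → Ω N → ℕ)
    (hX : ∀ N, 1 ≤ N →
      CouponCollector.IsSampling (P N) N (CouponCollector.couponProb f N) (X N)) :
    (∃ μ : Measure ℝ, IsProbabilityMeasure μ ∧
        ∀ y : ℝ, cdf μ y = CouponCollector.limitCDF m y) ∧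
      ∀ y : ℝ, Tendsto
        (fun N : ℕ =>
          (P N).real {ω | CouponCollector.normalizedTime f (X N) m N ω ≤ (y : EReal)})
        atTop (𝓝 (CouponCollector.limitCDF m y)) := by
  refine ⟨exists_cdf_eq_limitCDF m, fun y => ?_⟩
  have hmono : ∀ N, Monotone fun n => (P N).real (allCounts (X N) N (fun _ => m) n) :=
    fun N _ _ hab => measureReal_mono (allCounts_mono _ _ _ hab)
  have hR := fun z => hf.tendsto_prod_one_sub_poissonBelow hm z
  have hevent : ∀ᶠ N : ℕ in atTop,
      {ω | normalizedTime f (X N) m N ω ≤ (y : EReal)} =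
        allCounts (X N) N (fun _ => m) ⌊scaling f N * normTime f m y N⌋₊ := by
    filter_upwards [eventually_ge_atTop 1, (hf.tendsto_normTime m y).eventually_gt_atTop 0]
      with N hN hs
    have hk := hf.scaling_pos hN
    ext ω
    rw [← centering_add_scaling_mul]
    refine normalizedTime_le_iff (X N) m N ω hk ?_
    rw [centering_add_scaling_mul]
    positivity
  rw [tendsto_order]
  constructor
  · intro l hl
    -- Poissonize at the slightly earlier time `y - d`
    obtain ⟨d, hd, hdl⟩ : ∃ d > 0, l < limitCDF m (y - d) := by
      have hc : Tendsto (fun d => limitCDF m (y - d)) (𝓝[>] 0) (𝓝 (limitCDF m y)) := by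
        have := ((continuous_limitCDF m).comp (continuous_const.sub continuous_id)).tendsto
          (x := (0 : ℝ)) (f := fun d => limitCDF m (y - d))
        rw [sub_zero] at this
        exact this.mono_left nhdsWithin_le_nhds
      obtain ⟨d, h1, h2⟩ := ((hc.eventually_const_lt hl).and self_mem_nhdsWithin).exists
      exact ⟨d, h2, h1⟩
    have hlim := (hR (y - d)).sub (hf.tendsto_chebyshev_error m (y - d) hd)
    rw [sub_zero] at hlim
    filter_upwards [hlim.eventually_const_lt hdl, hevent, eventually_ge_atTop 1,
      (hf.tendsto_normTime m (y - d)).eventually_gt_atTop 0] with N h1 h2 hN h3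
    rw [h2]
    have hk := hf.scaling_pos hN
    refine h1.trans_le (poisson_average_sub_le (hmono N) (fun _ => measureReal_nonneg)
      (fun _ => measureReal_le_one) (mul_pos hk h3) (hf.hasSum_collection hN (hX N hN) m _)
      (mul_pos hk hd) ?_)
    rw [← mul_add, ← normTime_add, sub_add_cancel]
    exact (Nat.lt_floor_add_one _).le
  · intro l hl
    -- Poissonize at the slightly later time `y + d`
    obtain ⟨d, hd, hdl⟩ : ∃ d > 0, limitCDF m (y + d) < l := by
      have hc : Tendsto (fun d => limitCDF m (y + d)) (𝓝[>] 0) (𝓝 (limitCDF m y)) := by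
        have := ((continuous_limitCDF m).comp (continuous_const.add continuous_id)).tendsto
          (x := (0 : ℝ)) (f := fun d => limitCDF m (y + d))
        rw [add_zero] at this
        exact this.mono_left nhdsWithin_le_nhds
      obtain ⟨d, h1, h2⟩ := ((hc.eventually_lt_const hl).and self_mem_nhdsWithin).exists
      exact ⟨d, h2, h1⟩
    have hlim := (hR (y + d)).add (hf.tendsto_chebyshev_error m (y + d) hd)
    rw [add_zero] at hlim
    filter_upwards [hlim.eventually_lt_const hdl, hevent, eventually_ge_atTop 1,
      (hf.tendsto_normTime m y).eventually_gt_atTop 0] with N h1 h2 hN h3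
    rw [h2]
    have hk := hf.scaling_pos hN
    have h4 : normTime f m (y + d) N = normTime f m y N + d := normTime_add f m N y d
    refine (le_poisson_average_add (hmono N) (fun _ => measureReal_nonneg)
      (fun _ => measureReal_le_one) (t := scaling f N * normTime f m (y + d) N)
      (by rw [h4]; positivity) (hf.hasSum_collection hN (hX N hN) m _)
      (mul_pos hk hd) ?_).trans_lt h1
    rw [h4, mul_add]
    gcongr
    exact Nat.floor_le (by positivity)
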